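/- **Theorem 1 (Cumulative distribution function).** For $i=1,2$ let $0<\omega_i<1$ and $\lambda_i,a_i,b_i,c_i>0$, and let the fading $I_i$ have the mixture Exponential–Generalized-Gamma density $$f_{I_i}(x)=\frac{\omega_i}{\lambda_i}e^{-x/\lambda_i}+(1-\omega_i)\frac{c_i\,x^{a_ic_i-1}}{b_i^{a_ic_i}\Gamma(a_i)}e^{-(x/b_i)^{c_i}},\qquad x>0,$$ with $I_1,I_2$ independent. Let $r_i\in\{1,2\}$ ($r_i=1$ for heterodyne detection, $r_i=2$ for IM/DD), let $\gamma_i=(\eta I_i)^{r_i}/N_{0_i}$ with $\eta,N_{0_i}>0$ be the instantaneous SNR of hop $i$, and let $\mu_{r_i}$ be its average electrical SNR, that is, $$\mu_{1_i}=\frac{\mathbb E[\gamma_i]}{\omega_i\lambda_i+(1-\omega_i)b_i\Gamma(a_i+1/c_i)/\Gamma(a_i)},\qquad \mu_{2_i}=\frac{\mathbb E[\gamma_i]}{2\omega_i\lambda_i^2+(1-\omega_i)b_i^2\Gamma(a_i+2/c_i)/\Gamma(a_i)}$$ (for fading normalized to $\mathbb E[I_i]=1$ the first denominator is $1$, so $\mu_{1_i}=\mathbb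 E[\gamma_i]$). Let $C>0$ and let $\gamma_{\mathrm{e2e}}=\gamma_1\gamma_2/(\gamma_2+C)$ be the end-to-end SNR. Then for every $\gamma>0$ $$\begin{aligned}\Pr[\gamma_{\mathrm{e2e}}\le\gamma]=1&-\omega_1\omega_2\,\mathcal H\Big[(0,r_1);(1,r_2)\,\Big|\,\tfrac{\lambda_1^{r_1}\mu_{r_1}}{\gamma},\tfrac{C}{\lambda_2^{r_2}\mu_{r_2}}\Big]-\frac{\omega_1(1-\omega_2)}{\Gamma(a_2)}\mathcal H\Big[(0,r_1);\big(a_2,\tfrac{r_2}{c_2}\big)\,\Big|\,\tfrac{\lambda_1^{r_1}\mu_{r_1}}{\gamma},\tfrac{C}{b_2^{r_2}\mu_{r_2}}\Big]\\&-\frac{\omega_2(1-\omega_1)}{\Gamma(a_1)}\mathcal H\Big[\big(1-a_1,\tfrac{r_1}{c_1}\big);(1,r_2)\,\Big|\,\tfrac{b_1^{r_1}\mu_{r_1}}{\gamma},\tfrac{C}{\lambda_2^{r_2}\mu_{r_2}}\Big]\\&-\frac{(1-\omega_1)(1-\omega_2)}{\Gamma(a_1)\Gamma(a_2)}\mathcal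 H\Big[\big(1-a_1,\tfrac{r_1}{c_1}\big);\big(a_2,\tfrac{r_2}{c_2}\big)\,\Big|\,\tfrac{b_1^{r_1}\mu_{r_1}}{\gamma},\tfrac{C}{b_2^{r_2}\mu_{r_2}}\Big],\end{aligned}$$ where $$\mathcal H[(p,P);(f,F)\,|\,x,y]=\mathrm H^{0,1:0,1:2,0}_{1,0:1,1:0,2}\left[\begin{matrix}(1;1,1)\\--\end{matrix}\Bigg|\begin{matrix}(p,P)\\(0,1)\end{matrix}\Bigg|\begin{matrix}--\\(0,1)(f,F)\end{matrix}\Bigg|\,x,y\right]$$ is the bivariate Fox H-function $$\frac1{(2\pi i)^2}\int_{\mathcal C_1}\int_{\mathcal C_2}\Gamma(s+t)\,\frac{\Gamma(1-p+Ps)}{\Gamma(1+s)}\,\Gamma(-t)\,\Gamma(f-Ft)\,x^s\,y^t\,dt\,ds .$$ Here $\mathcal C_1,\mathcal C_2$ are vertical lines, directed upwards, that separate the poles of $\Gamma(-t),\Gamma(f-Ft)$ (to the right of $\mathcal C_2$) from those of $\Gamma(s+t),\Gamma(1-p+Ps)$ (to the left). In all four terms such lines exist, and for every choice of them the double integral converges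 absolutely and has the same value. -/

import Mathlib

open MeasureTheory ProbabilityTheory

noncomputable section

/-- The one-variable gamma quotient
`∏_{j ≤ n} Γ(1 - c_j + γ_j s) ∏_{j ≤ m} Γ(d_j - δ_j s)`
divided by `∏_{j > n} Γ(c_j - γ_j s) ∏_{j > m} Γ(1 - d_j + δ_j s)`.
Here `c j = (c_j, γ_j)` and `d j = (d_j, δ_j)`. (At a pole of a gamma factor of the denominator
the reciprocal is `0`, as it should be.) -/
def foxTheta (m n : ℕ) {p q : ℕ} (c : Fin p → ℝ × ℝ) (d : Fin q → ℝ × ℝ) (s : ℂ) : ℂ :=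
  (∏ j : Fin p,
    if (j : ℕ) < n then Complex.Gamma (1 - ((c j).1 : ℂ) + ((c j).2 : ℂ) * s)
    else (Complex.Gamma (((c j).1 : ℂ) - ((c j).2 : ℂ) * s))⁻¹) *
  (∏ j : Fin q,
    if (j : ℕ) < m then Complex.Gamma (((d j).1 : ℂ) - ((d j).2 : ℂ) * s)
    else (Complex.Gamma (1 - ((d j).1 : ℂ) + ((d j).2 : ℂ) * s))⁻¹)

/-- The two-variable gamma quotient `∏_{j ≤ n} Γ(1 - a_j + α_j s + A_j t)` divided by
`∏_{j > n} Γ(a_j - α_j s - A_j t) ∏_j Γ(1 - b_j + β_j s + B_j t)`.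
Here `a j = (a_j; α_j, A_j)` and `b j = (b_j; β_j, B_j)`. -/
def foxPhi (n : ℕ) {p q : ℕ} (a : Fin p → ℝ × ℝ × ℝ) (b : Fin q → ℝ × ℝ × ℝ) (s t : ℂ) : ℂ :=
  (∏ j : Fin p,
    if (j : ℕ) < n then
      Complex.Gamma (1 - ((a j).1 : ℂ) + ((a j).2.1 : ℂ) * s + ((a j).2.2 : ℂ) * t)
    else (Complex.Gamma (((a j).1 : ℂ) - ((a j).2.1 : ℂ) * s - ((a j).2.2 : ℂ) * t))⁻¹) *
  (∏ j : Fin q,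
    (Complex.Gamma (1 - ((b j).1 : ℂ) + ((b j).2.1 : ℂ) * s + ((b j).2.2 : ℂ) * t))⁻¹)

/-- The integrand `φ(s,t) θ₂(s) θ₃(t) x^s y^t` of the double Mellin–Barnes integral defining
`H^{0,n₁ : m₂,n₂ : m₃,n₃}_{p₁,q₁ : p₂,q₂ : p₃,q₃}[a; b | c; d | e; f | x, y]`. -/
def foxIntegrand (n₁ m₂ n₂ m₃ n₃ : ℕ) {p₁ q₁ p₂ q₂ p₃ q₃ : ℕ}
    (a : Fin p₁ → ℝ × ℝ × ℝ) (b : Fin q₁ → ℝ × ℝ × ℝ)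
    (c : Fin p₂ → ℝ × ℝ) (d : Fin q₂ → ℝ × ℝ)
    (e : Fin p₃ → ℝ × ℝ) (f : Fin q₃ → ℝ × ℝ) (x y s t : ℂ) : ℂ :=
  foxPhi n₁ a b s t * foxTheta m₂ n₂ c d s * foxTheta m₃ n₃ e f t * x ^ s * y ^ t

/-- The vertical lines `Re s = σ` and `Re t = τ` separate the poles: on them the poles of the
factors `Γ(d_j - δ_j s)` (resp. `Γ(f_j - F_j t)`) of the numerator lie to the right of the
`s`-line (resp. `t`-line), and those of the other numerator factors `Γ(1 - c_j + γ_j s)`,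
`Γ(1 - e_j + E_j t)`, `Γ(1 - a_j + α_j s + A_j t)` lie to the left. As the coefficients
`α_j, A_j, γ_j, δ_j, E_j, F_j` are positive, this says that all the numerator arguments have
positive real part. -/
def FoxSeparates (n₁ m₂ n₂ m₃ n₃ : ℕ) {p₁ p₂ q₂ p₃ q₃ : ℕ}
    (a : Fin p₁ → ℝ × ℝ × ℝ) (c : Fin p₂ → ℝ × ℝ) (d : Fin q₂ → ℝ × ℝ)
    (e : Fin p₃ → ℝ × ℝ) (f : Fin q₃ → ℝ × ℝ) (σ τ : ℝ) : Prop :=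
  (∀ j : Fin p₁, (j : ℕ) < n₁ → 0 < 1 - (a j).1 + (a j).2.1 * σ + (a j).2.2 * τ) ∧
  (∀ j : Fin p₂, (j : ℕ) < n₂ → 0 < 1 - (c j).1 + (c j).2 * σ) ∧
  (∀ j : Fin q₂, (j : ℕ) < m₂ → 0 < (d j).1 - (d j).2 * σ) ∧
  (∀ j : Fin p₃, (j : ℕ) < n₃ → 0 < 1 - (e j).1 + (e j).2 * τ) ∧
  (∀ j : Fin q₃, (j : ℕ) < m₃ → 0 < (f j).1 - (f j).2 * τ)

/-- `HasBivariateFoxH n₁ m₂ n₂ m₃ n₃ a b c d e f x y h`: the bivariate Fox H-function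
`H^{0,n₁ : m₂,n₂ : m₃,n₃}_{p₁,q₁ : p₂,q₂ : p₃,q₃}[a; b | c; d | e; f | x, y]`, that is
`(2πi)⁻² ∫_{L₁} ∫_{L₂} φ(s,t) θ₂(s) θ₃(t) x^s y^t dt ds`
with contours running upwards from `-i∞` to `i∞` and separating the poles, is well defined and
has the value `h`: separating vertical lines exist, and for every pair of them the double integral
converges absolutely and equals `h`. With `s = σ + iu`, `t = τ + iv` one has
`(2πi)⁻² ds dt = (2π)⁻² du dv`. -/
def HasBivariateFoxH (n₁ m₂ n₂ m₃ n₃ : ℕ) {p₁ q₁ p₂ q₂ p₃ q₃ : ℕ}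
    (a : Fin p₁ → ℝ × ℝ × ℝ) (b : Fin q₁ → ℝ × ℝ × ℝ)
    (c : Fin p₂ → ℝ × ℝ) (d : Fin q₂ → ℝ × ℝ)
    (e : Fin p₃ → ℝ × ℝ) (f : Fin q₃ → ℝ × ℝ) (x y h : ℂ) : Prop :=
  (∃ σ τ : ℝ, FoxSeparates n₁ m₂ n₂ m₃ n₃ a c d e f σ τ) ∧
  ∀ σ τ : ℝ, FoxSeparates n₁ m₂ n₂ m₃ n₃ a c d e f σ τ →
    Integrable (fun w : ℝ × ℝ => foxIntegrand n₁ m₂ n₂ m₃ n₃ a b c d e f x y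
      ((σ : ℂ) + w.1 * Complex.I) ((τ : ℂ) + w.2 * Complex.I)) ∧
    h = 1 / (2 * (Real.pi : ℂ)) ^ 2 *
      ∫ w : ℝ × ℝ, foxIntegrand n₁ m₂ n₂ m₃ n₃ a b c d e f x y
        ((σ : ℂ) + w.1 * Complex.I) ((τ : ℂ) + w.2 * Complex.I)

/-- The value of the bivariate Fox H-function is unique. -/
theorem HasBivariateFoxH.unique {n₁ m₂ n₂ m₃ n₃ : ℕ} {p₁ q₁ p₂ q₂ p₃ q₃ : ℕ}
    {a : Fin p₁ → ℝ × ℝ × ℝ} {b : Fin q₁ → ℝ × ℝ × ℝ}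
    {c : Fin p₂ → ℝ × ℝ} {d : Fin q₂ → ℝ × ℝ}
    {e : Fin p₃ → ℝ × ℝ} {f : Fin q₃ → ℝ × ℝ} {x y h h' : ℂ}
    (H : HasBivariateFoxH n₁ m₂ n₂ m₃ n₃ a b c d e f x y h)
    (H' : HasBivariateFoxH n₁ m₂ n₂ m₃ n₃ a b c d e f x y h') : h = h' := by
  obtain ⟨⟨σ, τ, hs⟩, H⟩ := H
  rw [(H σ τ hs).2, (H'.2 σ τ hs).2]

/-- Parameters of the mixture Exponential–Generalized-Gamma distribution: the mixture weight `ω`,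
the scale `lam` of the exponential part, and the parameters `a, b, c` of the generalized gamma
part. -/
structure EGGParams where
  (ω lam a b c : ℝ)
  ω_pos : 0 < ω
  ω_lt_one : ω < 1
  lam_pos : 0 < lam
  a_pos : 0 < a
  b_pos : 0 < b
  c_pos : 0 < c

namespace EGGParams

/-- The probability density function of the mixture Exponential–Generalized-Gamma distribution. -/
def pdf (p : EGGParams) (x : ℝ) : ℝ :=
  if 0 < x then
    p.ω / p.lam * Real.exp (-(x / p.lam)) +
      (1 - p.ω) * (p.c * x ^ (p.a * p.c - 1) / (p.b ^ (p.a * p.c) * Real.Gamma p.a)) *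
        Real.exp (-((x / p.b) ^ p.c))
  else 0

/-- The mixture Exponential–Generalized-Gamma distribution. -/
def law (p : EGGParams) : Measure ℝ :=
  volume.withDensity (fun x => ENNReal.ofReal (p.pdf x))

/-- The average electrical SNR of a hop with detection type `r` (`1`: heterodyne, `2`: IM/DD)
and mean SNR `meanSNR`. The two denominators are the first and the second moment of the fading.
The first one equals `1` when the fading is normalized to mean `1`; the average electrical SNR of
heterodyne detection then is the mean SNR itself. -/
def avgElectricalSNR (p : EGGParams) (r : ℕ) (meanSNR : ℝ) : ℝ :=
  if r = 1 then
    meanSNR / (p.ω * p.lam + p.b * (1 - p.ω) * Real.Gamma (p.a + 1 / p.c) / Real.Gamma p.a)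
  else
    meanSNR /
      (2 * p.ω * p.lam ^ 2 + p.b ^ 2 * (1 - p.ω) * Real.Gamma (p.a + 2 / p.c) / Real.Gamma p.a)

end EGGParams

end

/-! The exponential law is a generalized gamma law with `a = c = 1`, so each fading law mixes two
laws of variables `b * G ^ c⁻¹` with `G` gamma distributed. The average electrical SNR is `η ^ r /
N`, whence `γᵢ = μᵢ * Iᵢ ^ rᵢ`. By bilinearity of the product measure, the tail probability of the
end-to-end SNR splits into four terms. In each, the event becomes `1 + y * g₂ ^ (-F) < x * g₁ ^ P`
for independent gamma variables `g₁, g₂`. Conditioning on `g₂` yields an integral of an upper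
incomplete gamma function, `gammaTailIntegral`.

That integral is the Fox H-value by `mellinBarnes_gamma_gamma`. The coupling factor `Γ(s+t) Γ(-t) /
Γ(s)` is the beta integral of `w ^ (-t-1) * (1+w) ^ (-s)` over `w > 0`. Inserting it decouples `s`
from `t`. The `s`-integral is then the Mellin inversion of `Γ(a₁+Ps)/s`, an upper incomplete gamma
function. The `t`-integral inverts `Γ(a₂-Ft)` and gives a gamma weight. The substitution `w = y * g
^ (-F)` finishes. The computation works on every pair of separating lines, so independence of the
contour needs no contour shifting. -/

section

open Set Filter Topology

/-! ### Decay of the gamma function on vertical lines -/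

/-- The gamma function is dominated by its values on the real axis. -/
theorem norm_complexGamma_le {z : ℂ} (hz : 0 < z.re) : ‖Complex.Gamma z‖ ≤ Real.Gamma z.re := by
  rw [Complex.Gamma_eq_integral hz, Complex.GammaIntegral, Real.Gamma_eq_integral hz]
  refine (norm_integral_le_integral_norm _).trans_eq ?_
  refine setIntegral_congr_fun measurableSet_Ioi fun x hx => ?_
  have hx : 0 < x := hx
  simp only [norm_mul, Complex.norm_real, Real.norm_eq_abs, abs_of_pos (Real.exp_pos _)]
  rw [Complex.norm_cpow_eq_rpow_re_of_pos hx]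
  simp

theorem continuous_complexGamma_vertical {α : ℝ} (hα : 0 < α) :
    Continuous fun u : ℝ => Complex.Gamma (α + u * Complex.I) := by
  refine continuous_iff_continuousAt.2 fun u => ?_
  have h : ContinuousAt Complex.Gamma (α + u * Complex.I) := by
    refine (Complex.differentiableAt_Gamma _ fun m h => ?_).continuousAt
    have := congrArg Complex.re h
    simp at this
    have : (0 : ℝ) ≤ m := m.cast_nonneg
    linarith
  exact h.comp (f := fun u : ℝ => (α + u * Complex.I : ℂ)) (by fun_prop)

/-- The gamma function is integrable on vertical lines of the right half-plane. -/
theorem integrable_complexGamma_vertical {α : ℝ} (hα : 0 < α) :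
    Integrable fun u : ℝ => Complex.Gamma (α + u * Complex.I) := by
  -- The functional equation, used twice, turns boundedness of `Γ(z+2)` on the line into quadratic
  -- decay of `Γ(z)`. The constant `max (1 / α) 1` compensates for `‖z‖` being small near the real
  -- axis when `α < 1`.
  refine Integrable.mono' (g := fun u => Real.Gamma (α + 2) * (max (1 / α) 1) * (1 + u ^ 2)⁻¹)
    (integrable_inv_one_add_sq.const_mul _)
    (continuous_complexGamma_vertical hα).aestronglyMeasurable (ae_of_all _ fun u => ?_)
  set z : ℂ := α + u * Complex.I with hz
  have hre : z.re = α := by simp [hz]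
  have him : z.im = u := by simp [hz]
  have h0 : z ≠ 0 := fun h => by rw [h] at hre; simp at hre; linarith
  have h1 : z + 1 ≠ 0 := fun h => by
    have := congrArg Complex.re h
    simp [hre] at this; linarith
  have e : Complex.Gamma (z + 2) = (z + 1) * (z * Complex.Gamma z) := by
    rw [← Complex.Gamma_add_one z h0, ← Complex.Gamma_add_one (z + 1) h1]
    ring_nf
  have hG : ‖Complex.Gamma (z + 2)‖ ≤ Real.Gamma (α + 2) := by
    have := norm_complexGamma_le (z := z + 2) (by simp [hre]; linarith)
    simpa [hre] using this
  have hGp : 0 < Real.Gamma (α + 2) := Real.Gamma_pos_of_pos (by linarith)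
  rw [e, norm_mul, norm_mul] at hG
  have hm : 1 + u ^ 2 ≤ max (1 / α) 1 * (‖z + 1‖ * ‖z‖) := by
    have n1 : ‖z + 1‖ ^ 2 = (α + 1) ^ 2 + u ^ 2 := by
      rw [Complex.sq_norm, Complex.normSq_apply]; simp [hre, him]; ring
    have n0 : ‖z‖ ^ 2 = α ^ 2 + u ^ 2 := by
      rw [Complex.sq_norm, Complex.normSq_apply]; simp [hre, him]; ring
    refine abs_le_of_sq_le_sq' ?_ (by positivity) |>.2
    rw [mul_pow, mul_pow, n1, n0]
    set M := max (1 / α) 1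
    have hM1 : 1 ≤ M := le_max_right _ _
    have hM2 : 1 ≤ M * α := by
      have : 1 / α ≤ M := le_max_left _ _
      rwa [div_le_iff₀ hα] at this
    have k1 : 1 + u ^ 2 ≤ M ^ 2 * (α ^ 2 + u ^ 2) := by
      have : 1 ≤ (M * α) ^ 2 := one_le_pow₀ hM2
      have : 1 ≤ M ^ 2 := one_le_pow₀ hM1
      nlinarith [sq_nonneg u]
    have k2 : 1 + u ^ 2 ≤ (α + 1) ^ 2 + u ^ 2 := by nlinarith
    calc (1 + u ^ 2) ^ 2 = (1 + u ^ 2) * (1 + u ^ 2) := by ring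
      _ ≤ (M ^ 2 * (α ^ 2 + u ^ 2)) * ((α + 1) ^ 2 + u ^ 2) := by gcongr
      _ = _ := by ring
  rw [← div_eq_mul_inv, le_div_iff₀ (by positivity)]
  calc ‖Complex.Gamma z‖ * (1 + u ^ 2)
      ≤ ‖Complex.Gamma z‖ * (max (1 / α) 1 * (‖z + 1‖ * ‖z‖)) := by gcongr
    _ = max (1 / α) 1 * (‖z + 1‖ * (‖z‖ * ‖Complex.Gamma z‖)) := by ring
    _ ≤ max (1 / α) 1 * Real.Gamma (α + 2) := by gcongr
    _ = _ := by ring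

/-- A negative slope is allowed because the factor `Γ(a₂ - F t)` has one. -/
theorem integrable_complexGamma_affine {a P σ : ℝ} (hP : P ≠ 0) (h : 0 < a + P * σ) :
    Integrable fun u : ℝ => Complex.Gamma (a + P * (σ + u * Complex.I)) := by
  refine ((integrable_complexGamma_vertical h).comp_mul_left' hP).congr (ae_of_all _ fun u => ?_)
  simp only
  push_cast
  ring_nf

/-! ### The beta integral on the half-line -/

/-- The beta integral over the half-line. -/
theorem integral_Ioi_cpow_mul_one_add_cpow {p q : ℂ} (hp : 0 < p.re) (hq : 0 < q.re) :
    ∫ w in Ioi (0 : ℝ), (w : ℂ) ^ (q - 1) * (1 + w : ℂ) ^ (-(p + q)) =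
      Complex.Gamma p * Complex.Gamma q / Complex.Gamma (p + q) := by
  rw [← Complex.betaIntegral_eq_Gamma_mul_div _ _ hp hq, Complex.betaIntegral,
    intervalIntegral.integral_of_le zero_le_one, integral_Ioc_eq_integral_Ioo]
  -- The substitution `x = 1 / (1 + w)` carries the half-line to the unit interval of the standard
  -- beta integral.
  have him : (fun w : ℝ => (1 + w)⁻¹) '' Ioi 0 = Ioo (0 : ℝ) 1 := by
    ext x
    constructor
    · rintro ⟨w, hw, rfl⟩
      have hw : 0 < w := hw
      exact ⟨by positivity, inv_lt_one_of_one_lt₀ (by linarith)⟩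
    · rintro ⟨h0, h1⟩
      refine ⟨x⁻¹ - 1, ?_, by simp⟩
      simpa using (one_lt_inv₀ h0).2 h1
  rw [← him, integral_image_eq_integral_abs_deriv_smul (f' := fun w => -1 / (1 + w) ^ 2)
    measurableSet_Ioi]
  · refine setIntegral_congr_fun measurableSet_Ioi fun w hw => ?_
    have hw : 0 < w := hw
    have hw1 : 0 < 1 + w := by linarith
    have hw1' : (1 + w : ℂ) ≠ 0 := by exact_mod_cast hw1.ne'
    have e1 : (1 : ℂ) - (((1 + w)⁻¹ : ℝ) : ℂ) = ((w : ℝ) : ℂ) * (((1 + w)⁻¹ : ℝ) : ℂ) := by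
      push_cast; field_simp; ring
    have e2 : |(-1) / (1 + w) ^ 2| = ((1 + w)⁻¹) ^ 2 := by
      rw [abs_div, abs_of_pos (by positivity : 0 < (1 + w) ^ 2)]; simp
    have e3 : (((1 + w)⁻¹ : ℝ) : ℂ) = (1 + w : ℂ)⁻¹ := by push_cast; rfl
    have harg : (1 + w : ℂ).arg ≠ Real.pi := by
      rw [show (1 + w : ℂ) = ((1 + w : ℝ) : ℂ) by push_cast; rfl, Complex.arg_ofReal_of_nonneg hw1.le]
      exact Real.pi_pos.ne
    rw [e1, Complex.mul_cpow_ofReal_nonneg hw.le (by positivity), e2, Complex.real_smul]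
    push_cast
    rw [Complex.inv_cpow _ _ harg, Complex.inv_cpow _ _ harg, ← Complex.cpow_neg, ← Complex.cpow_neg,
      ← Complex.cpow_natCast, Complex.inv_cpow _ _ harg, ← Complex.cpow_neg]
    have : -(p + q) = (-((2 : ℕ) : ℂ)) + (-(p - 1)) + (-(q - 1)) := by push_cast; ring
    rw [this, Complex.cpow_add _ _ hw1', Complex.cpow_add _ _ hw1']
    ring
  · intro w hw
    have hw : 0 < w := hw
    have := ((hasDerivAt_id w).const_add 1).inv (by simp; linarith)
    exact (this.congr_deriv (by simp)).hasDerivWithinAt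
  · intro x hx y hy h
    simpa using h

theorem integrableOn_rpow_mul_one_add_rpow {p q : ℝ} (hp : 0 < p) (hq : 0 < q) :
    IntegrableOn (fun w : ℝ => w ^ (q - 1) * (1 + w) ^ (-(p + q))) (Ioi 0) := by
  have h : Integrable (fun w : ℝ => (w : ℂ) ^ ((q : ℂ) - 1) * (1 + w : ℂ) ^ (-((p : ℂ) + q)))
      (volume.restrict (Ioi 0)) := by
    -- The Bochner integral of a non-integrable function is `0`, so the nonzero closed form already
    -- proves integrability.
    refine Integrable.of_integral_ne_zero ?_
    rw [integral_Ioi_cpow_mul_one_add_cpow (by simpa) (by simpa), ← Complex.ofReal_add,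
      Complex.Gamma_ofReal, Complex.Gamma_ofReal, Complex.Gamma_ofReal]
    have h1 := Real.Gamma_pos_of_pos hp
    have h2 := Real.Gamma_pos_of_pos hq
    have h3 := Real.Gamma_pos_of_pos (add_pos hp hq)
    exact_mod_cast (by positivity : Real.Gamma p * Real.Gamma q / Real.Gamma (p + q) ≠ 0)
  refine h.re.congr ?_
  refine (ae_restrict_iff' measurableSet_Ioi).2 (ae_of_all _ fun w hw => ?_)
  have hw : 0 < w := hw
  have : (w : ℂ) ^ ((q : ℂ) - 1) * (1 + w : ℂ) ^ (-((p : ℂ) + q)) =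
      ((w ^ (q - 1) * (1 + w) ^ (-(p + q)) : ℝ) : ℂ) := by
    rw [Complex.ofReal_mul, Complex.ofReal_cpow hw.le, Complex.ofReal_cpow (by linarith)]
    push_cast; rfl
  simp only
  rw [this]
  simp

/-! ### Mellin transforms and their inversion -/

theorem hasMellin_rpow_mul_exp_neg {a : ℝ} {s : ℂ} (h : 0 < (s + a).re) :
    HasMellin (fun x : ℝ => ((x ^ a * Real.exp (-x) : ℝ) : ℂ)) s (Complex.Gamma (s + a)) := by
  have e : EqOn (fun x : ℝ => ((Real.exp (-x) : ℝ) : ℂ) * (x : ℂ) ^ (s + a - 1))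
      (fun x : ℝ => (x : ℂ) ^ (s - 1) • ((x ^ a * Real.exp (-x) : ℝ) : ℂ)) (Ioi 0) := by
    intro x hx
    have hx : 0 < x := hx
    have hx' : (x : ℂ) ≠ 0 := by exact_mod_cast hx.ne'
    simp only [smul_eq_mul]
    rw [Complex.ofReal_mul, Complex.ofReal_cpow hx.le, show s + a - 1 = (s - 1) + a by ring,
      Complex.cpow_add _ _ hx']
    ring
  refine ⟨(Complex.GammaIntegral_convergent h).congr_fun e measurableSet_Ioi, ?_⟩
  rw [Complex.Gamma_eq_integral h, Complex.GammaIntegral, mellin]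
  exact (setIntegral_congr_fun measurableSet_Ioi e).symm

/-- Mellin inversion for `f (x ^ P⁻¹)`, in terms of the Mellin transform `M` of `f`. -/
theorem mellin_inversion_comp_rpow {f : ℝ → ℂ} {M : ℂ → ℂ} {P σ z : ℝ} (hP : 0 < P) (hz : 0 < z)
    (hf : ∀ u : ℝ, HasMellin f (P * (σ + u * Complex.I)) (M (P * (σ + u * Complex.I))))
    (hM : Integrable fun u : ℝ => M (P * (σ + u * Complex.I)))
    (hc : ContinuousAt f (z ^ P⁻¹)) :
    1 / (2 * Real.pi) * ∫ u : ℝ, (z : ℂ) ^ (-(σ + u * Complex.I)) *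
      (P * M (P * (σ + u * Complex.I))) = f (z ^ P⁻¹) := by
  have hm : ∀ u : ℝ, mellin (fun x : ℝ => f (x ^ P⁻¹)) (σ + u * Complex.I) =
      P * M (P * (σ + u * Complex.I)) := fun u => by
    have : ((σ : ℂ) + u * Complex.I) / ((P⁻¹ : ℝ) : ℂ) = P * (σ + u * Complex.I) := by
      push_cast
      rw [div_inv_eq_mul, mul_comm]
    rw [mellin_comp_rpow, this, (hf u).2, abs_of_pos (inv_pos.2 hP), inv_inv, Complex.real_smul]
  have h := mellinInv_mellin_eq σ (fun x : ℝ => f (x ^ P⁻¹)) hz ?_ ?_ ?_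
  · rw [← h, mellinInv, Complex.real_smul]
    simp only [hm, smul_eq_mul]
    push_cast
    rfl
  · rw [MellinConvergent.comp_rpow (inv_pos.2 hP).ne']
    have := (hf 0).1
    convert this using 1
    push_cast
    rw [div_inv_eq_mul]
    ring
  · unfold Complex.VerticalIntegrable
    simp only [hm]
    exact hM.const_mul _
  · exact ContinuousAt.comp (f := fun x : ℝ => x ^ P⁻¹) hc
      (Real.continuousAt_rpow_const _ _ (Or.inl hz.ne'))

theorem mellin_inversion_rpow_mul_exp_neg {a P σ z : ℝ} (hP : 0 < P) (h : 0 < a + P * σ)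
    (hz : 0 < z) :
    1 / (2 * Real.pi) * ∫ u : ℝ, (z : ℂ) ^ (-(σ + u * Complex.I)) *
      (P * Complex.Gamma (a + P * (σ + u * Complex.I))) =
      (((z ^ P⁻¹) ^ a * Real.exp (-(z ^ P⁻¹)) : ℝ) : ℂ) := by
  refine mellin_inversion_comp_rpow (f := fun x : ℝ => ((x ^ a * Real.exp (-x) : ℝ) : ℂ))
    (M := fun s => Complex.Gamma (a + s)) hP hz (fun u => ?_)
    (integrable_complexGamma_affine hP.ne' h) ?_
  · rw [add_comm (a : ℂ)]
    refine hasMellin_rpow_mul_exp_neg ?_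
    simp; linarith
  · have : z ^ P⁻¹ ≠ 0 := (Real.rpow_pos_of_pos hz _).ne'
    refine Complex.continuous_ofReal.continuousAt.comp ?_
    exact (Real.continuousAt_rpow_const _ _ (Or.inl this)).mul (by fun_prop)

/-! ### The upper incomplete gamma function and its Mellin transform -/

/-- The upper incomplete gamma function. -/
noncomputable def upperGamma (a x : ℝ) : ℝ := ∫ g in Ioi x, g ^ (a - 1) * Real.exp (-g)

theorem integrableOn_rpow_mul_exp_neg {a : ℝ} (ha : 0 < a) :
    IntegrableOn (fun g : ℝ => g ^ (a - 1) * Real.exp (-g)) (Ioi 0) := by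
  refine (Real.GammaIntegral_convergent ha).congr_fun (fun g _ => ?_) measurableSet_Ioi
  simp only [mul_comm]

theorem continuousAt_upperGamma {a x : ℝ} (ha : 0 < a) (hx : 0 < x) :
    ContinuousAt (upperGamma a) x := by
  have e : ∀ y ∈ Ioi (0 : ℝ), upperGamma a y =
      upperGamma a 0 - ∫ g in (0 : ℝ)..y, g ^ (a - 1) * Real.exp (-g) := fun y hy => by
    have hy : 0 < y := hy
    have := intervalIntegral.integral_Ioi_sub_Ioi (integrableOn_rpow_mul_exp_neg ha) hy.le
    rw [upperGamma, upperGamma, ← this]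
    ring
  refine ContinuousAt.congr ?_ (Filter.eventuallyEq_of_mem (Ioi_mem_nhds hx) e).symm
  refine continuousAt_const.sub ?_
  have h : IntegrableOn (fun g : ℝ => g ^ (a - 1) * Real.exp (-g)) (uIcc 0 (x + 1)) := by
    rw [uIcc_of_le (by linarith), integrableOn_Icc_iff_integrableOn_Ioc]
    exact (integrableOn_rpow_mul_exp_neg ha).mono_set Ioc_subset_Ioi_self
  refine (intervalIntegral.continuousOn_primitive_interval h).continuousAt ?_
  rw [uIcc_of_le (by linarith)]
  exact Icc_mem_nhds hx (by linarith)

/-- Fubini on the region `0 < z < g`: integrating `z ^ (s-1)` up to `g` first gives `g ^ s / s`, and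
what remains is the integral of `Γ(a+s)`, divided by `s`. -/
theorem hasMellin_upperGamma {a : ℝ} {s : ℂ} (ha : 0 < a) (hs : 0 < s.re) :
    HasMellin (fun x => (upperGamma a x : ℂ)) s (Complex.Gamma (a + s) / s) := by
  have hs0 : s ≠ 0 := fun h => by simp [h] at hs
  set k : ℝ × ℝ → ℂ := fun w => {w : ℝ × ℝ | w.1 < w.2}.indicator
    (fun w => (w.1 : ℂ) ^ (s - 1) * ((w.2 ^ (a - 1) * Real.exp (-w.2) : ℝ) : ℂ)) w with hk
  have hkm : Measurable k := by
    refine Measurable.indicator ?_ (measurableSet_lt measurable_fst measurable_snd)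
    fun_prop
  have hksec : ∀ g ∈ Ioi (0 : ℝ), (fun z => k (z, g)) =
      (Iio g).indicator fun z => (z : ℂ) ^ (s - 1) * ((g ^ (a - 1) * Real.exp (-g) : ℝ) : ℂ) := by
    intro g hg
    ext z
    simp [hk, indicator]
  have hsec : ∀ g ∈ Ioi (0 : ℝ), IntegrableOn
      (fun z : ℝ => (z : ℂ) ^ (s - 1) * ((g ^ (a - 1) * Real.exp (-g) : ℝ) : ℂ)) (Ioo 0 g) := by
    intro g hg
    have hg : 0 < g := hg
    refine Integrable.mul_const ?_ _
    have := (intervalIntegral.intervalIntegrable_cpow' (a := 0) (b := g) (r := s - 1)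
      (by simpa using hs))
    rw [intervalIntegrable_iff_integrableOn_Ioc_of_le hg.le] at this
    exact this.mono_set Ioo_subset_Ioc_self
  have hint : ∀ g ∈ Ioi (0 : ℝ), ∫ z in Ioi (0 : ℝ), k (z, g) =
      (g : ℂ) ^ s / s * ((g ^ (a - 1) * Real.exp (-g) : ℝ) : ℂ) := by
    intro g hg
    have hg' : 0 < g := hg
    rw [hksec g hg, setIntegral_indicator measurableSet_Iio, Ioi_inter_Iio,
      integral_mul_const, ← integral_Ioc_eq_integral_Ioo, ← intervalIntegral.integral_of_le hg'.le,
      integral_cpow (Or.inl (by simpa using hs))]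
    simp [hs0]
  -- The same computation with `s` replaced by its real part supplies the absolute integrability
  -- behind Fubini.
  have hintn : ∀ g ∈ Ioi (0 : ℝ), ∫ z in Ioi (0 : ℝ), ‖k (z, g)‖ =
      1 / s.re * (g ^ ((a + s.re) - 1) * Real.exp (-g)) := by
    intro g hg
    have hg' : 0 < g := hg
    have e : (fun z => ‖k (z, g)‖) = (Iio g).indicator
        fun z => ‖(z : ℂ) ^ (s - 1) * ((g ^ (a - 1) * Real.exp (-g) : ℝ) : ℂ)‖ := by
      ext z
      rw [show k (z, g) = (fun z => k (z, g)) z from rfl, hksec g hg, norm_indicator_eq_indicator_norm]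
    have e2 : EqOn (fun z : ℝ => ‖(z : ℂ) ^ (s - 1) * ((g ^ (a - 1) * Real.exp (-g) : ℝ) : ℂ)‖)
        (fun z => z ^ (s.re - 1) * (g ^ (a - 1) * Real.exp (-g))) (Ioo 0 g) := by
      intro z hz
      have hz : 0 < z := hz.1
      simp only [norm_mul, Complex.norm_real, Real.norm_eq_abs]
      rw [Complex.norm_cpow_eq_rpow_re_of_pos hz, abs_of_nonneg (by positivity)]
      simp
    rw [e, setIntegral_indicator measurableSet_Iio, Ioi_inter_Iio,
      setIntegral_congr_fun measurableSet_Ioo e2,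
      integral_mul_const, ← integral_Ioc_eq_integral_Ioo, ← intervalIntegral.integral_of_le hg'.le,
      integral_rpow (Or.inl (by linarith)), show a + s.re - 1 = s.re + (a - 1) by ring,
      Real.rpow_add hg' s.re (a - 1)]
    simp only [sub_add_cancel, Real.zero_rpow hs.ne', sub_zero]
    ring
  have hki : Integrable k ((volume.restrict (Ioi (0 : ℝ))).prod (volume.restrict (Ioi (0 : ℝ)))) := by
    refine (integrable_prod_iff' hkm.aestronglyMeasurable).2 ⟨?_, ?_⟩
    · refine (ae_restrict_iff' measurableSet_Ioi).2 (ae_of_all _ fun g hg => ?_)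
      rw [hksec g hg, integrable_indicator_iff measurableSet_Iio, IntegrableOn,
        Measure.restrict_restrict measurableSet_Iio, Iio_inter_Ioi]
      exact hsec g hg
    · refine IntegrableOn.congr_fun ?_ (fun g hg => (hintn g hg).symm) measurableSet_Ioi
      exact (integrableOn_rpow_mul_exp_neg (by linarith)).const_mul _
  have hup : ∀ z ∈ Ioi (0 : ℝ), ∫ g in Ioi (0 : ℝ), k (z, g) =
      (z : ℂ) ^ (s - 1) • (upperGamma a z : ℂ) := by
    intro z hz
    have hz : 0 < z := hz
    have e : (fun g => k (z, g)) = (Ioi z).indicator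
        fun g => (z : ℂ) ^ (s - 1) * ((g ^ (a - 1) * Real.exp (-g) : ℝ) : ℂ) := by
      ext g
      simp [hk, indicator]
    rw [e, setIntegral_indicator measurableSet_Ioi, Ioi_inter_Ioi, max_eq_right hz.le,
      integral_const_mul, integral_complex_ofReal]
    rfl
  constructor
  · exact IntegrableOn.congr_fun hki.integral_prod_left hup measurableSet_Ioi
  · rw [mellin, ← setIntegral_congr_fun measurableSet_Ioi hup]
    have := integral_integral_swap (f := fun z g => k (z, g)) hki
    rw [this, setIntegral_congr_fun measurableSet_Ioi hint, Complex.Gamma_eq_integral (by simp; linarith),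
      Complex.GammaIntegral, ← integral_div]
    refine setIntegral_congr_fun measurableSet_Ioi fun g hg => ?_
    have hg : 0 < g := hg
    have hg' : (g : ℂ) ≠ 0 := by exact_mod_cast hg.ne'
    rw [Complex.ofReal_mul, Complex.ofReal_cpow hg.le, show (a : ℂ) + s - 1 = s + (a - 1) by ring,
      Complex.cpow_add _ _ hg']
    push_cast
    ring

theorem integrable_complexGamma_affine_div {a P σ : ℝ} (hP : P ≠ 0) (h : 0 < a + P * σ)
    (hσ : 0 < σ) :
    Integrable fun u : ℝ => Complex.Gamma (a + P * (σ + u * Complex.I)) / (σ + u * Complex.I) := by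
  have h0 : ∀ u : ℝ, (σ + u * Complex.I : ℂ) ≠ 0 := fun u h => by
    have := congrArg Complex.re h
    simp at this; linarith
  refine ((integrable_complexGamma_affine hP h).norm.mul_const σ⁻¹).mono' ?_ (ae_of_all _ fun u => ?_)
  · refine (integrable_complexGamma_affine hP h).aestronglyMeasurable.mul ?_
    refine Continuous.aestronglyMeasurable ?_
    exact Continuous.inv₀ (by fun_prop) h0
  · rw [norm_div, div_eq_mul_inv]
    gcongr
    refine le_trans ?_ (Complex.abs_re_le_norm _)
    simp [le_abs_self]

theorem mellin_inversion_upperGamma {a P σ z : ℝ} (hP : 0 < P) (ha : 0 < a) (hσ : 0 < σ)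
    (hz : 0 < z) :
    1 / (2 * Real.pi) * ∫ u : ℝ, (z : ℂ) ^ (-(σ + u * Complex.I)) *
      (Complex.Gamma (a + P * (σ + u * Complex.I)) / (σ + u * Complex.I)) =
      (upperGamma a (z ^ P⁻¹) : ℂ) := by
  have hP' : (P : ℂ) ≠ 0 := by exact_mod_cast hP.ne'
  -- The Jacobian factor `P` of the change of exponent cancels against the denominator `P * s`.
  have e : ∀ s : ℂ, P * (Complex.Gamma (a + P * s) / (P * s)) = Complex.Gamma (a + P * s) / s := by
    intro s
    rw [← mul_div_assoc, mul_div_mul_left _ _ hP']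
  have hi := integrable_complexGamma_affine_div hP.ne' (by positivity : 0 < a + P * σ) hσ
  rw [← mellin_inversion_comp_rpow (f := fun x => (upperGamma a x : ℂ))
    (M := fun s => Complex.Gamma (a + s) / s) (σ := σ) hP hz (fun u => ?_) ?_ ?_]
  · simp only [e]
  · refine (hi.const_mul (P : ℂ)⁻¹).congr (ae_of_all _ fun u => ?_)
    simp only
    rw [← e, inv_mul_cancel_left₀ hP']
  · exact Complex.continuous_ofReal.continuousAt.comp
      (continuousAt_upperGamma ha (Real.rpow_pos_of_pos hz _))
  · refine hasMellin_upperGamma ha ?_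
    simp; positivity

/-! ### The double Mellin–Barnes integral -/

theorem cpow_mul_cpow_neg_eq_div_cpow {x w : ℝ} (hx : 0 < x) (hw : 0 < w) (s : ℂ) :
    (x : ℂ) ^ s * (w : ℂ) ^ (-s) = ((w / x : ℝ) : ℂ) ^ (-s) := by
  have harg : (x : ℂ).arg ≠ Real.pi := by
    rw [Complex.arg_ofReal_of_nonneg hx.le]
    exact Real.pi_pos.ne
  rw [div_eq_mul_inv, Complex.ofReal_mul, Complex.mul_cpow_ofReal_nonneg hw.le (by positivity),
    Complex.ofReal_inv, Complex.inv_cpow _ _ harg, Complex.cpow_neg _ s, Complex.cpow_neg _ s,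
    inv_inv]
  ring

/-- Substitute `w = y * g ^ (-F)`: then `(y / w) ^ F⁻¹ = g`, and `dw / w` becomes `F dg / g` up to
orientation. -/
theorem integral_inv_mul_comp_rpow {F y a : ℝ} (hF : 0 < F) (hy : 0 < y) (U : ℝ → ℝ) :
    ∫ w in Ioi (0 : ℝ), w⁻¹ * (F⁻¹ * (((y / w) ^ F⁻¹) ^ a * Real.exp (-((y / w) ^ F⁻¹)))) * U w =
      ∫ g in Ioi (0 : ℝ), g ^ (a - 1) * Real.exp (-g) * U (y * g ^ (-F)) := by
  have h1 := integral_comp_mul_left_Ioi' (fun w : ℝ =>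
    w⁻¹ * (F⁻¹ * (((y / w) ^ F⁻¹) ^ a * Real.exp (-((y / w) ^ F⁻¹)))) * U w) 0 hy
  rw [mul_zero] at h1
  rw [← h1, ← integral_comp_rpow_Ioi _ (neg_ne_zero.2 hF.ne'), smul_eq_mul, ← integral_const_mul]
  refine setIntegral_congr_fun measurableSet_Ioi fun g hg => ?_
  have hg : 0 < g := hg
  have e : y / (y * g ^ (-F)) = g ^ F := by
    rw [Real.rpow_neg hg.le]; field_simp
  simp only [smul_eq_mul, abs_neg, abs_of_pos hF]
  rw [e, Real.rpow_rpow_inv hg.le hF.ne', Real.rpow_sub_one hg.ne', Real.rpow_sub_one hg.ne']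
  have : 0 < g ^ (-F) := Real.rpow_pos_of_pos hg _
  field_simp

/-- The double Mellin–Barnes integral with kernel `Γ(s+t) Γ(-t) / Γ(1+s)` and gamma weights. -/
theorem mellinBarnes_gamma_gamma {a₁ a₂ P F x y σ τ : ℝ} (ha₁ : 0 < a₁) (ha₂ : 0 < a₂) (hP : 0 < P)
    (hF : 0 < F) (hx : 0 < x) (hy : 0 < y) (hστ : 0 < σ + τ) (hτ : τ < 0)
    {J : ℂ → ℂ → ℂ}
    (hJ : ∀ s t, J s t = Complex.Gamma (s + t) * (Complex.Gamma (a₁ + P * s) *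
      (Complex.Gamma (1 + s))⁻¹) * (Complex.Gamma (-t) * Complex.Gamma (a₂ - F * t)) *
      x ^ s * y ^ t) :
    Integrable (fun w : ℝ × ℝ => J (σ + w.1 * Complex.I) (τ + w.2 * Complex.I)) ∧
    1 / (2 * (Real.pi : ℂ)) ^ 2 *
      ∫ w : ℝ × ℝ, J (σ + w.1 * Complex.I) (τ + w.2 * Complex.I) =
    ((∫ g in Ioi (0 : ℝ), g ^ (a₂ - 1) * Real.exp (-g) *
      upperGamma a₁ (((1 + y * g ^ (-F)) / x) ^ P⁻¹) : ℝ) : ℂ) := by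
  have hσ : 0 < σ := by linarith
  set S : ℝ → ℂ := fun u => σ + u * Complex.I with hS
  set T : ℝ → ℂ := fun v => τ + v * Complex.I with hT
  have hSre : ∀ u, (S u).re = σ := fun u => by simp [hS]
  have hTre : ∀ v, (T v).re = τ := fun v => by simp [hT]
  have hScont : Continuous S := by fun_prop
  have hTcont : Continuous T := by fun_prop
  have hS0 : ∀ u, S u ≠ 0 := fun u h => by
    have := hSre u
    rw [h] at this; simp at this; linarith
  set A : ℝ → ℂ := fun u => x ^ S u * (Complex.Gamma (a₁ + P * S u) / S u) with hA
  set B : ℝ → ℂ := fun v => y ^ T v * Complex.Gamma (a₂ - F * T v) with hB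
  -- The integrand with the beta integral written out. For fixed `w.2` it is a product of a function
  -- of `s` and a function of `t`.
  set K : (ℝ × ℝ) × ℝ → ℂ := fun w =>
    A w.1.1 * B w.1.2 * ((w.2 : ℂ) ^ (-T w.1.2 - 1) * (1 + w.2 : ℂ) ^ (-S w.1.1)) with hK
  have hx0 : (x : ℂ) ≠ 0 := by exact_mod_cast hx.ne'
  have hy0 : (y : ℂ) ≠ 0 := by exact_mod_cast hy.ne'
  have hAi : Integrable A := by
    have h := integrable_complexGamma_affine_div hP.ne' (by positivity : 0 < a₁ + P * σ) hσ
    refine h.bdd_mul (c := x ^ σ) (Continuous.aestronglyMeasurable ?_) (ae_of_all _ fun u => ?_)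
    · exact hScont.const_cpow (Or.inl hx0)
    · rw [Complex.norm_cpow_eq_rpow_re_of_pos hx, hSre]
  have hGB : Integrable fun v : ℝ => Complex.Gamma (a₂ - F * T v) := by
    have h := integrable_complexGamma_affine (a := a₂) (P := -F) (σ := τ) (by linarith)
      (by nlinarith)
    refine h.congr (ae_of_all _ fun v => ?_)
    simp only [hT]
    push_cast
    ring_nf
  have hBi : Integrable B := by
    refine hGB.bdd_mul (c := y ^ τ) (Continuous.aestronglyMeasurable ?_) (ae_of_all _ fun u => ?_)
    · exact hTcont.const_cpow (Or.inl hy0)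
    · rw [Complex.norm_cpow_eq_rpow_re_of_pos hy, hTre]
  have hW := integrableOn_rpow_mul_one_add_rpow hστ (neg_pos.2 hτ)
  have hKi : Integrable K ((volume : Measure (ℝ × ℝ)).prod (volume.restrict (Ioi (0 : ℝ)))) := by
    refine ((hAi.norm.mul_prod hBi.norm).mul_prod hW).mono' ?_ ?_
    · refine AEStronglyMeasurable.mul ?_ ?_
      · exact (hAi.mul_prod hBi).aestronglyMeasurable.comp_fst
      · refine Measurable.aestronglyMeasurable ?_
        have := hScont.measurable
        have := hTcont.measurable
        fun_prop
    · have hpos : ∀ᵐ w : (ℝ × ℝ) × ℝ ∂((volume : Measure (ℝ × ℝ)).prod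
          (volume.restrict (Ioi (0 : ℝ)))), 0 < w.2 :=
        Measure.quasiMeasurePreserving_snd.ae (ae_restrict_mem measurableSet_Ioi)
      filter_upwards [hpos] with w hw
      have h1 : (1 + w.2 : ℂ) = ((1 + w.2 : ℝ) : ℂ) := by push_cast; rfl
      rw [hK]
      simp only [norm_mul]
      rw [h1, Complex.norm_cpow_eq_rpow_re_of_pos hw,
        Complex.norm_cpow_eq_rpow_re_of_pos (by linarith)]
      simp [hSre, hTre]
  have hJK : ∀ w : ℝ × ℝ, ∫ z in Ioi (0 : ℝ), K (w, z) = J (S w.1) (T w.2) := by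
    rintro ⟨u, v⟩
    simp only [hK]
    rw [integral_const_mul]
    -- With `p = s + t` and `q = -t` the denominator is `Γ(s)`; the extra `1 / s` in `A` turns it
    -- into `Γ(1+s)`.
    have h := integral_Ioi_cpow_mul_one_add_cpow (p := S u + T v) (q := -T v)
      (by simp [hSre, hTre]; linarith) (by simp [hTre]; linarith)
    rw [add_neg_cancel_right] at h
    rw [h, hJ, add_comm 1, Complex.Gamma_add_one _ (hS0 u)]
    simp only [hA, hB]
    rw [mul_inv]
    simp only [div_eq_mul_inv]
    ring
  have hπ : (2 * (Real.pi : ℂ)) ≠ 0 := by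
    simp [Real.pi_ne_zero]
  have hAw : ∀ w : ℝ, 0 < w → ∫ u, A u * (1 + w : ℂ) ^ (-S u) =
      2 * Real.pi * (upperGamma a₁ (((1 + w) / x) ^ P⁻¹) : ℂ) := by
    intro w hw
    have hw1 : 0 < 1 + w := by linarith
    rw [← mellin_inversion_upperGamma hP ha₁ hσ (by positivity), ← mul_assoc, mul_one_div_cancel hπ,
      one_mul]
    congr 1
    ext u
    rw [← cpow_mul_cpow_neg_eq_div_cpow hx hw1]
    simp only [hA]
    push_cast
    ring
  have hBw : ∀ w : ℝ, 0 < w → ∫ v, B v * (w : ℂ) ^ (-T v) =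
      2 * Real.pi * ((F⁻¹ * (((y / w) ^ F⁻¹) ^ a₂ * Real.exp (-((y / w) ^ F⁻¹))) : ℝ) : ℂ) := by
    intro w hw
    have hF' : (F : ℂ) ≠ 0 := by exact_mod_cast hF.ne'
    -- The reflection `v ↦ -v` makes this a Mellin inversion along the line of real part `-τ > 0`.
    rw [Complex.ofReal_mul, ← mellin_inversion_rpow_mul_exp_neg (σ := -τ) hF (by nlinarith)
      (by positivity), ← integral_neg_eq_self (fun v => B v * (w : ℂ) ^ (-T v))]
    have e : ∀ v : ℝ, ((y / w : ℝ) : ℂ) ^ (-(((-τ : ℝ) : ℂ) + v * Complex.I)) *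
        (F * Complex.Gamma (a₂ + F * (((-τ : ℝ) : ℂ) + v * Complex.I))) =
        F * (B (-v) * (w : ℂ) ^ (-T (-v))) := by
      intro v
      have e1 : ((-τ : ℝ) : ℂ) + v * Complex.I = -T (-v) := by
        simp only [hT]; push_cast; ring
      rw [e1, ← cpow_mul_cpow_neg_eq_div_cpow hw hy]
      simp only [hB, neg_neg]
      ring_nf
    simp only [e]
    rw [integral_const_mul]
    push_cast
    field_simp
  have hswap : ∫ w : ℝ × ℝ, J (S w.1) (T w.2) =
      ∫ z in Ioi (0 : ℝ), ∫ w : ℝ × ℝ, K (w, z) := by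
    rw [← integral_integral_swap (f := fun w z => K (w, z)) hKi]
    exact integral_congr_ae (ae_of_all _ fun w => (hJK w).symm)
  -- Absolute convergence of the double integral is inherited from that of the triple integral.
  refine ⟨hKi.integral_prod_left.congr (ae_of_all _ hJK), ?_⟩
  have hz : ∀ z ∈ Ioi (0 : ℝ), ∫ w : ℝ × ℝ, K (w, z) = (2 * (Real.pi : ℂ)) ^ 2 *
      ((z⁻¹ * (F⁻¹ * (((y / z) ^ F⁻¹) ^ a₂ * Real.exp (-((y / z) ^ F⁻¹)))) *
        upperGamma a₁ (((1 + z) / x) ^ P⁻¹) : ℝ) : ℂ) := by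
    intro z hz
    have hz : 0 < z := hz
    have hz0 : (z : ℂ) ≠ 0 := by exact_mod_cast hz.ne'
    have e : (fun w : ℝ × ℝ => K (w, z)) = fun w : ℝ × ℝ =>
        (z : ℂ)⁻¹ * ((A w.1 * (1 + z : ℂ) ^ (-S w.1)) * (B w.2 * (z : ℂ) ^ (-T w.2))) := by
      ext w
      simp only [hK]
      rw [Complex.cpow_sub _ _ hz0, Complex.cpow_one]
      ring
    rw [e, integral_const_mul, Measure.volume_eq_prod,
      integral_prod_mul (fun u => A u * (1 + z : ℂ) ^ (-S u)) (fun v => B v * (z : ℂ) ^ (-T v)),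
      hAw z hz, hBw z hz]
    push_cast
    ring
  rw [hswap, setIntegral_congr_fun measurableSet_Ioi hz, integral_const_mul, ← mul_assoc,
    one_div, inv_mul_cancel₀ (pow_ne_zero _ hπ), one_mul, integral_complex_ofReal,
    integral_inv_mul_comp_rpow hF hy fun w => upperGamma a₁ (((1 + w) / x) ^ P⁻¹)]

/-! ### Gamma variables and the tail event -/

theorem measurable_gammaPDF (a r : ℝ) : Measurable (gammaPDF a r) :=
  (measurable_gammaPDFReal a r).ennreal_ofReal

theorem integral_gammaMeasure {a : ℝ} (ha : 0 < a) (f : ℝ → ℝ) :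
    ∫ g, f g ∂gammaMeasure a 1 =
      (Real.Gamma a)⁻¹ * ∫ g in Ioi (0 : ℝ), g ^ (a - 1) * Real.exp (-g) * f g := by
  have h : (fun g => (gammaPDF a 1 g).toReal • f g) = (Ici 0).indicator fun g =>
      (Real.Gamma a)⁻¹ * (g ^ (a - 1) * Real.exp (-g) * f g) := by
    ext g
    rw [gammaPDF, ENNReal.toReal_ofReal (gammaPDFReal_nonneg ha one_pos g), gammaPDFReal]
    by_cases hg : 0 ≤ g
    · rw [indicator_of_mem (by exact hg), if_pos hg]
      simp
      ring
    · rw [indicator_of_notMem (by exact hg), if_neg hg]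
      simp
  rw [gammaMeasure, integral_withDensity_eq_integral_toReal_smul
    (measurable_gammaPDF a 1) (ae_of_all _ fun g => ENNReal.ofReal_lt_top), h,
    integral_indicator measurableSet_Ici, integral_const_mul, integral_Ici_eq_integral_Ioi]

theorem ae_gammaMeasure_pos (a : ℝ) : ∀ᵐ g ∂gammaMeasure a 1, 0 < g := by
  rw [gammaMeasure, ae_withDensity_iff (measurable_gammaPDF a 1)]
  filter_upwards [Measure.ae_ne volume (0 : ℝ)] with g hg0 hg
  by_contra h
  exact hg (gammaPDF_of_neg (lt_of_le_of_ne (not_lt.1 h) hg0))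

theorem gammaMeasure_real_Ioi {a x : ℝ} (ha : 0 < a) (hx : 0 ≤ x) :
    (gammaMeasure a 1).real (Ioi x) = (Real.Gamma a)⁻¹ * upperGamma a x := by
  rw [← integral_indicator_one measurableSet_Ioi, integral_gammaMeasure ha, upperGamma]
  have : (fun g => g ^ (a - 1) * Real.exp (-g) * (Ioi x).indicator 1 g) =
      (Ioi x).indicator fun g => g ^ (a - 1) * Real.exp (-g) := by
    ext g
    simp [indicator]
  rw [this, setIntegral_indicator measurableSet_Ioi, Ioi_inter_Ioi, max_eq_right hx]

/-- The common value of the double Mellin–Barnes integrals. -/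
noncomputable def gammaTailIntegral (a₁ P a₂ F x y : ℝ) : ℝ :=
  ∫ g in Ioi (0 : ℝ), g ^ (a₂ - 1) * Real.exp (-g) *
    upperGamma a₁ (((1 + y * g ^ (-F)) / x) ^ P⁻¹)

/-- Given `g₂ > 0`, the event says that `g₁` exceeds `((1 + y * g₂ ^ (-F)) / x) ^ P⁻¹`, whose
probability is a normalized upper incomplete gamma function. -/
theorem gammaMeasure_prod_real {a₁ a₂ P F x y : ℝ} (ha₁ : 0 < a₁) (ha₂ : 0 < a₂) (hP : 0 < P)
    (hx : 0 < x) (hy : 0 < y) :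
    ((gammaMeasure a₁ 1).prod (gammaMeasure a₂ 1)).real
      {g : ℝ × ℝ | 1 + y * g.2 ^ (-F) < x * g.1 ^ P} =
      (Real.Gamma a₁ * Real.Gamma a₂)⁻¹ * gammaTailIntegral a₁ P a₂ F x y := by
  have := isProbabilityMeasure_gammaMeasure ha₁ one_pos
  have := isProbabilityMeasure_gammaMeasure ha₂ one_pos
  have hm : MeasurableSet {g : ℝ × ℝ | 1 + y * g.2 ^ (-F) < x * g.1 ^ P} :=
    measurableSet_lt (by fun_prop) (by fun_prop)
  have hsec : ∀ g₂ ∈ Ioi (0 : ℝ), ∫ g₁, {g : ℝ × ℝ | 1 + y * g.2 ^ (-F) < x * g.1 ^ P}.indicator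
      (1 : ℝ × ℝ → ℝ) (g₁, g₂) ∂gammaMeasure a₁ 1 =
      (Real.Gamma a₁)⁻¹ * upperGamma a₁ (((1 + y * g₂ ^ (-F)) / x) ^ P⁻¹) := by
    intro g₂ hg₂
    have hg₂ : 0 < g₂ := hg₂
    have hz : 0 < (1 + y * g₂ ^ (-F)) / x := by positivity
    rw [← gammaMeasure_real_Ioi ha₁ (by positivity), ← integral_indicator_one measurableSet_Ioi]
    refine integral_congr_ae ?_
    filter_upwards [ae_gammaMeasure_pos a₁] with g₁ hg₁
    have : 1 + y * g₂ ^ (-F) < x * g₁ ^ P ↔ ((1 + y * g₂ ^ (-F)) / x) ^ P⁻¹ < g₁ := by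
      rw [← div_lt_iff₀' hx, Real.rpow_inv_lt_iff_of_pos hz.le hg₁.le hP]
    simp only [indicator, mem_ofPred_eq, mem_Ioi, this]
    rfl
  have hi : Integrable ({g : ℝ × ℝ | 1 + y * g.2 ^ (-F) < x * g.1 ^ P}.indicator
      (1 : ℝ × ℝ → ℝ)) ((gammaMeasure a₁ 1).prod (gammaMeasure a₂ 1)) :=
    (integrable_const (1 : ℝ)).indicator hm
  rw [← integral_indicator_one hm, integral_prod_symm _ hi, integral_gammaMeasure ha₂]
  have : ∀ g ∈ Ioi (0 : ℝ), _ := fun g hg =>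
    congrArg (fun z => g ^ (a₂ - 1) * Real.exp (-g) * z) (hsec g hg)
  rw [setIntegral_congr_fun measurableSet_Ioi this, gammaTailIntegral, ← integral_const_mul,
    ← integral_const_mul]
  congr 1
  ext g
  rw [mul_inv]
  ring

/-! ### Generalized gamma laws, the mixture and its moments -/

/-- The generalized gamma distribution, as the law of `b * G ^ c⁻¹` for a gamma variable `G`. -/
noncomputable def genGammaMeasure (a b c : ℝ) : Measure ℝ :=
  (gammaMeasure a 1).map fun g => b * g ^ c⁻¹

theorem isProbabilityMeasure_genGammaMeasure {a : ℝ} (ha : 0 < a) (b c : ℝ) :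
    IsProbabilityMeasure (genGammaMeasure a b c) := by
  have := isProbabilityMeasure_gammaMeasure ha one_pos
  exact Measure.isProbabilityMeasure_map (by fun_prop)

/-- Change of variables `g = (x / b) ^ c` on the positive half-line, which carries all the mass of
the gamma law. -/
theorem genGammaMeasure_eq_withDensity {a b c : ℝ} (hb : 0 < b) (hc : 0 < c) :
    genGammaMeasure a b c = volume.withDensity fun x => ENNReal.ofReal (if 0 < x then
      c * x ^ (a * c - 1) / (b ^ (a * c) * Real.Gamma a) * Real.exp (-((x / b) ^ c)) else 0) := by
  ext s hs
  have hφ : Measurable fun g : ℝ => b * g ^ c⁻¹ := by fun_prop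
  have him : (fun x : ℝ => (x / b) ^ c) '' Ioi 0 = Ioi 0 := by
    ext g
    constructor
    · rintro ⟨x, hx, rfl⟩
      have hx : 0 < x := hx
      exact Real.rpow_pos_of_pos (by positivity) _
    · intro hg
      have hg : 0 < g := hg
      refine ⟨b * g ^ c⁻¹, mul_pos hb (Real.rpow_pos_of_pos hg _), ?_⟩
      simp only
      rw [mul_div_cancel_left₀ _ hb.ne', Real.rpow_inv_rpow hg.le hc.ne']
  have hr : ∀ᵐ g : ℝ, g ∈ Iio (0 : ℝ) ∪ Ioi 0 := by
    filter_upwards [Measure.ae_ne volume (0 : ℝ)] with g hg using hg.lt_or_gt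
  rw [genGammaMeasure, Measure.map_apply hφ hs, gammaMeasure, withDensity_apply _ (hφ hs),
    withDensity_apply _ hs, ← lintegral_indicator (hφ hs), ← lintegral_indicator hs]
  have h0 : ∫⁻ g, ((fun g : ℝ => b * g ^ c⁻¹) ⁻¹' s).indicator (gammaPDF a 1) g =
      ∫⁻ g in Ioi (0 : ℝ), ((fun g : ℝ => b * g ^ c⁻¹) ⁻¹' s).indicator (gammaPDF a 1) g := by
    rw [← lintegral_indicator measurableSet_Ioi]
    refine lintegral_congr_ae ?_
    filter_upwards [hr] with g hg
    rcases hg with hg | hg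
    · rw [indicator_of_notMem (s := Ioi (0 : ℝ)) (lt_asymm (mem_Iio.1 hg))]
      simp [indicator, gammaPDF_of_neg hg]
    · rw [indicator_of_mem (s := Ioi (0 : ℝ)) hg]
  rw [h0, ← him, lintegral_image_eq_lintegral_abs_deriv_mul measurableSet_Ioi
    (f' := fun x => c * (x / b) ^ (c - 1) * b⁻¹), ← lintegral_indicator measurableSet_Ioi]
  · refine lintegral_congr fun x => ?_
    by_cases hx : 0 < x
    · rw [indicator_of_mem (s := Ioi (0 : ℝ)) hx]
      have hxb : 0 < x / b := by positivity
      have e : b * ((x / b) ^ c) ^ c⁻¹ = x := by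
        rw [Real.rpow_rpow_inv hxb.le hc.ne']
        field_simp
      by_cases hxs : x ∈ s
      · rw [indicator_of_mem (by rwa [mem_preimage, e]), indicator_of_mem hxs, if_pos hx,
          gammaPDF_of_nonneg (by positivity), ← ENNReal.ofReal_mul (by positivity)]
        congr 1
        have h1 : x ^ (a * c - 1) = x ^ (c - 1) * x ^ (c * (a - 1)) := by
          rw [← Real.rpow_add hx]; ring_nf
        have h2 : b ^ (a * c) = b * (b ^ (c - 1) * b ^ (c * (a - 1))) := by
          rw [← Real.rpow_add hb, mul_comm b, ← Real.rpow_add_one hb.ne']; ring_nf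
        rw [abs_of_pos (by positivity), Real.one_rpow, one_mul, ← Real.rpow_mul hxb.le,
          Real.div_rpow hx.le hb.le, Real.div_rpow hx.le hb.le, h1, h2]
        simp only [div_eq_mul_inv, mul_inv]
        ring
      · rw [indicator_of_notMem (by rwa [mem_preimage, e]), indicator_of_notMem hxs, mul_zero]
    · rw [indicator_of_notMem (s := Ioi (0 : ℝ)) hx]
      simp [indicator, hx]
  · intro x hx
    have hx : 0 < x := hx
    have h := ((hasDerivAt_id x).div_const b).rpow_const (p := c) (Or.inl (by
      simp only [id]; positivity))
    refine (h.congr_deriv ?_).hasDerivWithinAt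
    simp only [id]
    ring
  · intro x hx y hy h
    have hx : 0 < x := hx
    have hy : 0 < y := hy
    have := (Real.rpow_left_inj (by positivity) (by positivity) hc.ne').1 h
    field_simp at this
    exact this

/-- Treating the exponential component as generalized gamma lets a single computation serve all four
terms of the distribution function. -/
theorem EGGParams.law_eq (p : EGGParams) :
    p.law = ENNReal.ofReal p.ω • genGammaMeasure 1 p.lam 1 +
      ENNReal.ofReal (1 - p.ω) • genGammaMeasure p.a p.b p.c := by
  obtain ⟨ω, lam, a, b, c, hω, hω1, hlam, ha, hb, hc⟩ := p
  simp only
  rw [genGammaMeasure_eq_withDensity hlam one_pos, genGammaMeasure_eq_withDensity hb hc,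
    ← withDensity_smul' _ _ ENNReal.ofReal_ne_top, ← withDensity_smul' _ _ ENNReal.ofReal_ne_top,
    ← withDensity_add_left]
  · rw [EGGParams.law]
    congr 1
    ext x
    simp only [Pi.add_apply, Pi.smul_apply, smul_eq_mul, EGGParams.pdf]
    by_cases hx : 0 < x
    · have hω2 : 0 ≤ 1 - ω := by linarith
      simp only [if_pos hx]
      rw [← ENNReal.ofReal_mul hω.le, ← ENNReal.ofReal_mul hω2, ← ENNReal.ofReal_add
        (by positivity) (by positivity)]
      congr 1
      simp
      ring
    · simp [hx]
  · refine Measurable.const_smul ?_ _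
    refine Measurable.ennreal_ofReal ?_
    exact Measurable.ite (measurableSet_Ioi (a := (0 : ℝ))) (by fun_prop) measurable_const

theorem integral_pow_genGammaMeasure {a b c : ℝ} (ha : 0 < a) (hc : 0 < c) (r : ℕ) :
    ∫ x, x ^ r ∂genGammaMeasure a b c = b ^ r * Real.Gamma (a + r / c) / Real.Gamma a := by
  have hp : 0 < a + r / c := by positivity
  rw [genGammaMeasure, integral_map (by fun_prop) (by fun_prop), integral_gammaMeasure ha,
    Real.Gamma_eq_integral hp]
  have h : ∫ g in Ioi (0 : ℝ), g ^ (a - 1) * Real.exp (-g) * (b * g ^ c⁻¹) ^ r =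
      b ^ r * ∫ g in Ioi (0 : ℝ), Real.exp (-g) * g ^ (a + r / c - 1) := by
    rw [← integral_const_mul]
    refine setIntegral_congr_fun measurableSet_Ioi fun g hg => ?_
    have hg : 0 < g := hg
    rw [mul_pow, ← Real.rpow_natCast (g ^ c⁻¹) r, ← Real.rpow_mul hg.le,
      show a + r / c - 1 = (a - 1) + c⁻¹ * r by ring, Real.rpow_add hg]
    ring
  rw [h]
  ring

theorem integrable_pow_genGammaMeasure {a b c : ℝ} (ha : 0 < a) (hb : 0 < b) (hc : 0 < c) (r : ℕ) :
    Integrable (fun x => x ^ r) (genGammaMeasure a b c) := by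
  refine Integrable.of_integral_ne_zero ?_
  rw [integral_pow_genGammaMeasure ha hc]
  have := Real.Gamma_pos_of_pos ha
  have := Real.Gamma_pos_of_pos (by positivity : 0 < a + r / c)
  positivity

theorem EGGParams.integral_pow_law (p : EGGParams) (r : ℕ) :
    ∫ x, x ^ r ∂p.law = p.ω * (p.lam ^ r * r.factorial) +
      (1 - p.ω) * (p.b ^ r * Real.Gamma (p.a + r / p.c) / Real.Gamma p.a) := by
  rw [p.law_eq, integral_add_measure, integral_smul_measure, integral_smul_measure,
    integral_pow_genGammaMeasure one_pos one_pos,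
    integral_pow_genGammaMeasure p.a_pos p.c_pos, ENNReal.toReal_ofReal p.ω_pos.le,
    ENNReal.toReal_ofReal (by linarith [p.ω_lt_one]), div_one, add_comm (1 : ℝ),
    Real.Gamma_nat_eq_factorial]
  · simp
  · exact (integrable_pow_genGammaMeasure one_pos p.lam_pos one_pos r).smul_measure
      ENNReal.ofReal_ne_top
  · exact (integrable_pow_genGammaMeasure p.a_pos p.b_pos p.c_pos r).smul_measure
      ENNReal.ofReal_ne_top

/-- The average electrical SNR of a hop is `η ^ r / N`, whatever the distribution of the fading. -/
theorem EGGParams.avgElectricalSNR_eq {Ω : Type*} [MeasurableSpace Ω] {P : Measure Ω}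
    (p : EGGParams) {r : ℕ} (hr : r = 1 ∨ r = 2) {I : Ω → ℝ} (hI : HasLaw I p.law P) (η N : ℝ) :
    p.avgElectricalSNR r (∫ z, (η * I z) ^ r / N ∂P) = η ^ r / N := by
  have hE : ∫ z, (η * I z) ^ r / N ∂P = η ^ r / N * ∫ x, x ^ r ∂p.law := by
    rw [← hI.integral_comp (f := fun x => x ^ r) (by fun_prop), ← integral_const_mul]
    congr 1
    ext z
    simp only [Function.comp, mul_pow]
    ring
  have hω := p.ω_pos
  have hω1 : 0 < 1 - p.ω := by linarith [p.ω_lt_one]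
  have hl := p.lam_pos
  have hb := p.b_pos
  have ha := p.a_pos
  have hc := p.c_pos
  have hG := Real.Gamma_pos_of_pos ha
  rw [hE, p.integral_pow_law]
  rcases hr with rfl | rfl
  · have h1 : 0 < Real.Gamma (p.a + 1 / p.c) := Real.Gamma_pos_of_pos (by positivity)
    rw [EGGParams.avgElectricalSNR, if_pos rfl, div_eq_iff (by positivity)]
    simp only [Nat.cast_one, Nat.factorial]
    ring
  · have h1 : 0 < Real.Gamma (p.a + 2 / p.c) := Real.Gamma_pos_of_pos (by positivity)
    rw [EGGParams.avgElectricalSNR, if_neg (by norm_num), div_eq_iff (by positivity)]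
    simp only [Nat.cast_ofNat, Nat.factorial, Nat.succ_eq_add_one]
    push_cast
    ring

/-! ### From the end-to-end SNR to the Fox H-function -/

theorem genGammaMeasure_prod_real {a₁ b₁ c₁ a₂ b₂ c₂ μ₁ μ₂ C γ : ℝ} (ha₁ : 0 < a₁) (hb₁ : 0 < b₁)
    (hc₁ : 0 < c₁) (ha₂ : 0 < a₂) (hb₂ : 0 < b₂) (hμ₁ : 0 < μ₁) (hμ₂ : 0 < μ₂)
    (hC : 0 < C) (hγ : 0 < γ) {r₁ r₂ : ℕ} (hr₁ : 0 < r₁) :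
    ((genGammaMeasure a₁ b₁ c₁).prod (genGammaMeasure a₂ b₂ c₂)).real
      {w : ℝ × ℝ | γ < μ₁ * w.1 ^ r₁ * (μ₂ * w.2 ^ r₂) / (μ₂ * w.2 ^ r₂ + C)} =
      (Real.Gamma a₁ * Real.Gamma a₂)⁻¹ * gammaTailIntegral a₁ (r₁ / c₁) a₂ (r₂ / c₂)
        (b₁ ^ r₁ * μ₁ / γ) (C / (b₂ ^ r₂ * μ₂)) := by
  have := isProbabilityMeasure_gammaMeasure ha₁ one_pos
  have := isProbabilityMeasure_gammaMeasure ha₂ one_pos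
  have hm : MeasurableSet
      {w : ℝ × ℝ | γ < μ₁ * w.1 ^ r₁ * (μ₂ * w.2 ^ r₂) / (μ₂ * w.2 ^ r₂ + C)} :=
    measurableSet_lt (by fun_prop) (by fun_prop)
  rw [← gammaMeasure_prod_real ha₁ ha₂ (by positivity) (by positivity) (by positivity),
    genGammaMeasure, genGammaMeasure, Measure.map_prod_map _ _ (by fun_prop) (by fun_prop),
    map_measureReal_apply (by fun_prop) hm]
  refine measureReal_congr ?_
  have h₁ : ∀ᵐ g : ℝ × ℝ ∂((gammaMeasure a₁ 1).prod (gammaMeasure a₂ 1)), 0 < g.1 :=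
    Measure.quasiMeasurePreserving_fst.ae (ae_gammaMeasure_pos a₁)
  have h₂ : ∀ᵐ g : ℝ × ℝ ∂((gammaMeasure a₁ 1).prod (gammaMeasure a₂ 1)), 0 < g.2 :=
    Measure.quasiMeasurePreserving_snd.ae (ae_gammaMeasure_pos a₂)
  -- Almost surely both gamma variables are positive, so the powers combine. Dividing `γ < γ₁γ₂ /
  -- (γ₂ + C)` by `γ` and by `γ₂ / (γ₂ + C)` then gives `1 + C / γ₂ < γ₁ / γ`.
  filter_upwards [h₁, h₂] with g hg₁ hg₂
  have e : ∀ {g : ℝ}, 0 < g → ∀ (b c : ℝ) (r : ℕ),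
      (b * g ^ c⁻¹) ^ r = b ^ r * g ^ (r / c : ℝ) := by
    intro g hg b c r
    rw [mul_pow, ← Real.rpow_natCast (g ^ c⁻¹) r, ← Real.rpow_mul hg.le, div_eq_inv_mul]
  refine propext ?_
  change γ < μ₁ * (b₁ * g.1 ^ c₁⁻¹) ^ r₁ * (μ₂ * (b₂ * g.2 ^ c₂⁻¹) ^ r₂) /
    (μ₂ * (b₂ * g.2 ^ c₂⁻¹) ^ r₂ + C) ↔ 1 + C / (b₂ ^ r₂ * μ₂) * g.2 ^ (-(r₂ / c₂) : ℝ) <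
      b₁ ^ r₁ * μ₁ / γ * g.1 ^ (r₁ / c₁ : ℝ)
  rw [e hg₁, e hg₂, Real.rpow_neg hg₂.le]
  have hx := Real.rpow_pos_of_pos hg₁ (r₁ / c₁ : ℝ)
  have hy := Real.rpow_pos_of_pos hg₂ (r₂ / c₂ : ℝ)
  generalize g.1 ^ (r₁ / c₁ : ℝ) = X at *
  generalize g.2 ^ (r₂ / c₂ : ℝ) = Y at *
  have e1 : 1 + C / (b₂ ^ r₂ * μ₂) * Y⁻¹ = (μ₂ * (b₂ ^ r₂ * Y) + C) / (μ₂ * (b₂ ^ r₂ * Y)) := by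
    field_simp
  rw [e1, div_lt_iff₀ (by positivity), lt_div_iff₀ (by positivity),
    show b₁ ^ r₁ * μ₁ / γ * X * (μ₂ * (b₂ ^ r₂ * Y)) =
      μ₁ * (b₁ ^ r₁ * X) * (μ₂ * (b₂ ^ r₂ * Y)) / γ by ring, lt_div_iff₀ hγ, mul_comm γ]

theorem hasBivariateFoxH_gammaTailIntegral {a₁ P a₂ F x y : ℝ} (ha₁ : 0 < a₁) (ha₂ : 0 < a₂)
    (hP : 0 < P) (hF : 0 < F) (hx : 0 < x) (hy : 0 < y) :
    HasBivariateFoxH 1 0 1 2 0 ![(1, 1, 1)] ![] ![(1 - a₁, P)] ![(0, 1)] ![] ![(0, 1), (a₂, F)]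
      (x : ℂ) (y : ℂ) (gammaTailIntegral a₁ P a₂ F x y : ℂ) := by
  have key : ∀ σ τ : ℝ, FoxSeparates 1 0 1 2 0 ![(1, 1, 1)] ![(1 - a₁, P)] ![(0, 1)] ![]
      ![(0, 1), (a₂, F)] σ τ ↔ 0 < σ + τ ∧ 0 < a₁ + P * σ ∧ τ < 0 ∧ 0 < a₂ - F * τ := by
    intro σ τ
    simp [FoxSeparates, Fin.forall_fin_two]
  -- Any pair with `0 < -τ < σ` would do: these inequalities imply the other two conditions.
  refine ⟨⟨2, -1, (key _ _).2 ⟨by norm_num, by positivity, by norm_num, by linarith⟩⟩, ?_⟩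
  intro σ τ h
  obtain ⟨h1, -, h2, -⟩ := (key σ τ).1 h
  have := mellinBarnes_gamma_gamma ha₁ ha₂ hP hF hx hy h1 h2
    (J := fun s t => foxIntegrand 1 0 1 2 0 ![(1, 1, 1)] ![] ![(1 - a₁, P)] ![(0, 1)] ![]
      ![(0, 1), (a₂, F)] x y s t) (by
    intro s t
    simp [foxIntegrand, foxPhi, foxTheta, Fin.prod_univ_two])
  exact ⟨this.1, this.2.symm⟩

end

theorem theorem1 {Ω : Type*} [MeasurableSpace Ω] (P : Measure Ω) [IsProbabilityMeasure P]
    (k₁ k₂ : EGGParams) (r₁ r₂ : ℕ) (hr₁ : r₁ = 1 ∨ r₁ = 2) (hr₂ : r₂ = 1 ∨ r₂ = 2)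
    -- the independent fading coefficients of the two hops
    (I₁ I₂ : Ω → ℝ) (hI₁ : HasLaw I₁ k₁.law P) (hI₂ : HasLaw I₂ k₂.law P)
    (hI : IndepFun I₁ I₂ P)
    -- the instantaneous SNRs and the average electrical SNRs of the two hops
    (η N₁ N₂ : ℝ) (hη : 0 < η) (hN₁ : 0 < N₁) (hN₂ : 0 < N₂)
    (γ₁ γ₂ : Ω → ℝ) (hγ₁ : ∀ z, γ₁ z = (η * I₁ z) ^ r₁ / N₁)
    (hγ₂ : ∀ z, γ₂ z = (η * I₂ z) ^ r₂ / N₂)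
    (μ₁ μ₂ : ℝ) (hμ₁ : μ₁ = k₁.avgElectricalSNR r₁ (∫ z, γ₁ z ∂P))
    (hμ₂ : μ₂ = k₂.avgElectricalSNR r₂ (∫ z, γ₂ z ∂P))
    (C : ℝ) (hC : 0 < C) (γ : ℝ) (hγ : 0 < γ) :
    ∃ H₁ H₂ H₃ H₄ : ℂ,
      HasBivariateFoxH 1 0 1 2 0 ![(1, 1, 1)] ![] ![(0, (r₁ : ℝ))] ![(0, 1)]
        ![] ![(0, 1), (1, (r₂ : ℝ))]
        ((k₁.lam ^ r₁ * μ₁ / γ : ℝ) : ℂ) ((C / (k₂.lam ^ r₂ * μ₂) : ℝ) : ℂ) H₁ ∧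
      HasBivariateFoxH 1 0 1 2 0 ![(1, 1, 1)] ![] ![(0, (r₁ : ℝ))] ![(0, 1)]
        ![] ![(0, 1), (k₂.a, (r₂ : ℝ) / k₂.c)]
        ((k₁.lam ^ r₁ * μ₁ / γ : ℝ) : ℂ) ((C / (k₂.b ^ r₂ * μ₂) : ℝ) : ℂ) H₂ ∧
      HasBivariateFoxH 1 0 1 2 0 ![(1, 1, 1)] ![] ![(1 - k₁.a, (r₁ : ℝ) / k₁.c)] ![(0, 1)]
        ![] ![(0, 1), (1, (r₂ : ℝ))]
        ((k₁.b ^ r₁ * μ₁ / γ : ℝ) : ℂ) ((C / (k₂.lam ^ r₂ * μ₂) : ℝ) : ℂ) H₃ ∧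
      HasBivariateFoxH 1 0 1 2 0 ![(1, 1, 1)] ![] ![(1 - k₁.a, (r₁ : ℝ) / k₁.c)] ![(0, 1)]
        ![] ![(0, 1), (k₂.a, (r₂ : ℝ) / k₂.c)]
        ((k₁.b ^ r₁ * μ₁ / γ : ℝ) : ℂ) ((C / (k₂.b ^ r₂ * μ₂) : ℝ) : ℂ) H₄ ∧
      ((P.real {z | γ₁ z * γ₂ z / (γ₂ z + C) ≤ γ} : ℝ) : ℂ) =
        1 - ((k₁.ω * k₂.ω : ℝ) : ℂ) * H₁
          - ((k₁.ω * (1 - k₂.ω) / Real.Gamma k₂.a : ℝ) : ℂ) * H₂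
          - ((k₂.ω * (1 - k₁.ω) / Real.Gamma k₁.a : ℝ) : ℂ) * H₃
          - (((1 - k₁.ω) * (1 - k₂.ω) / (Real.Gamma k₁.a * Real.Gamma k₂.a) : ℝ) : ℂ) * H₄ := by
  have hE₁ : (fun z => (η * I₁ z) ^ r₁ / N₁) = γ₁ := funext fun z => (hγ₁ z).symm
  have hE₂ : (fun z => (η * I₂ z) ^ r₂ / N₂) = γ₂ := funext fun z => (hγ₂ z).symm
  rw [← hE₁, k₁.avgElectricalSNR_eq hr₁ hI₁] at hμ₁
  rw [← hE₂, k₂.avgElectricalSNR_eq hr₂ hI₂] at hμ₂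
  have hμ₁p : 0 < μ₁ := by rw [hμ₁]; positivity
  have hμ₂p : 0 < μ₂ := by rw [hμ₂]; positivity
  have hr₁p : 0 < r₁ := by omega
  have hr₂p : 0 < r₂ := by omega
  obtain ⟨ω₁, l₁, a₁, b₁, c₁, hω₁, hω₁', hl₁, ha₁, hb₁, hc₁⟩ := k₁
  obtain ⟨ω₂, l₂, a₂, b₂, c₂, hω₂, hω₂', hl₂, ha₂, hb₂, hc₂⟩ := k₂
  have hω₁c : 0 ≤ 1 - ω₁ := by linarith
  have hω₂c : 0 ≤ 1 - ω₂ := by linarith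
  simp only
  have hx : ∀ l : ℝ, 0 < l → 0 < l ^ r₁ * μ₁ / γ := fun l hl => by positivity
  have hy : ∀ l : ℝ, 0 < l → 0 < C / (l ^ r₂ * μ₂) := fun l hl => by positivity
  have hr₁' : (0 : ℝ) < r₁ := by exact_mod_cast hr₁p
  have hr₂' : (0 : ℝ) < r₂ := by exact_mod_cast hr₂p
  have G₁ := isProbabilityMeasure_genGammaMeasure (one_pos : (0 : ℝ) < 1) l₁ 1
  have G₂ := isProbabilityMeasure_genGammaMeasure ha₁ b₁ c₁
  have G₃ := isProbabilityMeasure_genGammaMeasure (one_pos : (0 : ℝ) < 1) l₂ 1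
  have G₄ := isProbabilityMeasure_genGammaMeasure ha₂ b₂ c₂
  -- An exponential component enters with shape and power `1`; its Fox parameter `1 - a₁` is then
  -- `0`.
  refine ⟨gammaTailIntegral 1 r₁ 1 r₂ (l₁ ^ r₁ * μ₁ / γ) (C / (l₂ ^ r₂ * μ₂)),
    gammaTailIntegral 1 r₁ a₂ (r₂ / c₂) (l₁ ^ r₁ * μ₁ / γ) (C / (b₂ ^ r₂ * μ₂)),
    gammaTailIntegral a₁ (r₁ / c₁) 1 r₂ (b₁ ^ r₁ * μ₁ / γ) (C / (l₂ ^ r₂ * μ₂)),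
    gammaTailIntegral a₁ (r₁ / c₁) a₂ (r₂ / c₂) (b₁ ^ r₁ * μ₁ / γ) (C / (b₂ ^ r₂ * μ₂)),
    ?_, ?_, ?_, ?_, ?_⟩
  · simpa only [sub_self] using
      hasBivariateFoxH_gammaTailIntegral one_pos one_pos hr₁' hr₂' (hx l₁ hl₁) (hy l₂ hl₂)
  · simpa only [sub_self] using
      hasBivariateFoxH_gammaTailIntegral one_pos ha₂ hr₁' (div_pos hr₂' hc₂) (hx l₁ hl₁) (hy b₂ hb₂)
  · exact hasBivariateFoxH_gammaTailIntegral ha₁ one_pos (div_pos hr₁' hc₁) hr₂' (hx b₁ hb₁)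
      (hy l₂ hl₂)
  · exact hasBivariateFoxH_gammaTailIntegral ha₁ ha₂ (div_pos hr₁' hc₁) (div_pos hr₂' hc₂)
      (hx b₁ hb₁) (hy b₂ hb₂)
  set S : Set (ℝ × ℝ) :=
    {w | γ < μ₁ * w.1 ^ r₁ * (μ₂ * w.2 ^ r₂) / (μ₂ * w.2 ^ r₂ + C)} with hS
  have hSm : MeasurableSet S := measurableSet_lt (by fun_prop) (by fun_prop)
  have hset : {z | γ₁ z * γ₂ z / (γ₂ z + C) ≤ γ} = (fun z => (I₁ z, I₂ z)) ⁻¹' Sᶜ := by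
    ext z
    have e₁ : γ₁ z = μ₁ * I₁ z ^ r₁ := by rw [hγ₁, hμ₁]; ring
    have e₂ : γ₂ z = μ₂ * I₂ z ^ r₂ := by rw [hγ₂, hμ₂]; ring
    rw [Set.mem_ofPred_eq, e₁, e₂]
    exact not_lt.symm
  have hlaw := hI.hasLaw_prod hI₁ hI₂
  have hprob := hlaw.isProbabilityMeasure_iff.1 ‹_›
  rw [hset, ← map_measureReal_apply_of_aemeasurable hlaw.aemeasurable hSm.compl, hlaw.map_eq,
    probReal_compl_eq_one_sub hSm, EGGParams.law_eq, EGGParams.law_eq]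
  have K := fun {a b c a' b' c' : ℝ} (ha : 0 < a) (hb : 0 < b) (hc : 0 < c) (ha' : 0 < a')
    (hb' : 0 < b') => genGammaMeasure_prod_real (c₂ := c') (r₂ := r₂) ha hb hc ha' hb' hμ₁p hμ₂p
      hC hγ hr₁p
  -- Finiteness of the weighted components is needed to distribute the product over sums and to take
  -- real-valued measures of them.
  have F := fun (μ : Measure ℝ) [IsFiniteMeasure μ] (r : ℝ) =>
    μ.smul_finite (ENNReal.ofReal_ne_top (r := r))
  have F₁ := F (genGammaMeasure 1 l₁ 1) ω₁
  have F₂ := F (genGammaMeasure a₁ b₁ c₁) (1 - ω₁)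
  have F₃ := F (genGammaMeasure 1 l₂ 1) ω₂
  have F₄ := F (genGammaMeasure a₂ b₂ c₂) (1 - ω₂)
  rw [Measure.add_prod, Measure.prod_add, Measure.prod_add, measureReal_add_apply,
    measureReal_add_apply, measureReal_add_apply]
  simp only [Measure.prod_smul_left, Measure.prod_smul_right, measureReal_ennreal_smul_apply, ENNReal.toReal_ofReal hω₁.le,
    ENNReal.toReal_ofReal hω₂.le, ENNReal.toReal_ofReal hω₁c, ENNReal.toReal_ofReal hω₂c]
  rw [K one_pos hl₁ one_pos one_pos hl₂, K one_pos hl₁ one_pos ha₂ hb₂,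
    K ha₁ hb₁ hc₁ one_pos hl₂, K ha₁ hb₁ hc₁ ha₂ hb₂]
  simp only [Real.Gamma_one, div_one]
  push_cast
  ring
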